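/- Let $(\Omega,\mathcal F,\mu)$ be a complete $\sigma$-finite measure space and let $H$ be a separable real Hilbert space with Borel $\sigma$-algebra $\mathcal B_H$. For every $\omega\in\Omega$, let $A_\omega\colon H\to 2^H$ be maximally monotone, i.e. $\langle x-y, x^*-y^*\rangle\ge 0$ for all $x^*\in A_\omega x$ and $y^*\in A_\omega y$, and the graph $\operatorname{gra}A_\omega=\{(x,x^*)\in H\times H : x^*\in A_\omega x\}$ is not strictly contained in the graph of another monotone operator. On the Hilbert space $\mathcal H=L^2(\Omega,\mathcal F,\mu;H)$ define $$A\colon\mathcal H\to 2^{\mathcal H}\colon x\mapsto\{x^*\in\mathcal H : x^*(\omega)\in A_\omega(x(\omega))\ \text{for $\mu$-almost every }\omega\in\Omega\},$$ and suppose that $\operatorname{dom}A=\{x\in\mathcal H : Ax\neq\varnothing\}$ is nonempty. Then, for every $\omega\in\Omega$ and $x\in H$, the value $J_{A_\omega}x$ of the resolvent $J_{A_\omega}=(\mathrm{Id}+A_\omega)^{-1}$ consists of exactly one point (with which it is identified), and the following are equivalent: (i) $A$ is maximally monotone. (ii) For every $x\in H$, the mapping $\Omega\to H\colon\omega\mapsto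 J_{A_\omega}x$ is $(\mathcal F,\mathcal B_H)$-measurable. (iii) For every open set $V$ in $H\oplus H$, $\{\omega\in\Omega : V\cap\operatorname{gra}A_\omega\neq\varnothing\}\in\mathcal F$. -/

import Mathlib

open MeasureTheory
open scoped ENNReal

/-- A set-valued operator on `H`. -/
abbrev SetValuedOp (H : Type*) := H → Set H

namespace SetValuedOp

section Basic

variable {H : Type*}

/-- The graph `gra A`. The product `H × H` carries the topology of the Hilbert sum `H ⊕ H`. -/
def gra (A : SetValuedOp H) : Set (H × H) := {p | p.2 ∈ A p.1}

/-- The domain `dom A`: the points at which `A` has a nonempty value. -/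
def dom (A : SetValuedOp H) : Set H := {x | (A x).Nonempty}

/-- The inverse operator, whose graph is obtained from `gra A` by swapping the coordinates. -/
def inverse (A : SetValuedOp H) : SetValuedOp H := fun y => {x | y ∈ A x}

end Basic

section Hilbert

variable {H : Type*} [NormedAddCommGroup H] [InnerProductSpace ℝ H]

/-- `A` is monotone. -/
def IsMonotone (A : SetValuedOp H) : Prop :=
  ∀ x y : H, ∀ x' ∈ A x, ∀ y' ∈ A y, 0 ≤ inner ℝ (x - y) (x' - y')

/-- `A` is maximally monotone: it is monotone and no monotone operator has a strictly larger
graph. -/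
def IsMaximallyMonotone (A : SetValuedOp H) : Prop :=
  A.IsMonotone ∧ ¬ ∃ B : SetValuedOp H, B.IsMonotone ∧ A.gra ⊂ B.gra

/-- The operator `Id + A`. -/
def idAdd (A : SetValuedOp H) : SetValuedOp H := fun x => {y | ∃ x' ∈ A x, y = x + x'}

/-- The resolvent `J_A = (Id + A)⁻¹`, as a set-valued operator. -/
def resolventOp (A : SetValuedOp H) : SetValuedOp H := (idAdd A).inverse

open Classical in
/-- The resolvent as a point-valued mapping: when `J_A x` is a singleton, this is its element
(and `0` where `J_A x` is empty). -/
noncomputable def resolventMap (A : SetValuedOp H) (x : H) : H :=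
  if h : (A.resolventOp x).Nonempty then h.some else 0

end Hilbert

end SetValuedOp

/-- The operator on `L²(Ω; H)` induced by a family of set-valued operators on `H`: `x'` belongs to
its value at `x` when `x' ω ∈ A ω (x ω)` for almost every `ω`. -/
def inducedOp {Ω H : Type*} [MeasurableSpace Ω] [NormedAddCommGroup H]
    (μ : Measure Ω) (A : Ω → SetValuedOp H) : SetValuedOp (Lp H 2 μ) :=
  fun x => {x' | ∀ᵐ ω ∂μ, x' ω ∈ A ω (x ω)}

namespace SetValuedOp

/-! By Minty's theorem and its converse, a monotone operator is maximal iff `Id + A` is onto; the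
resolvent is then single-valued and 1-Lipschitz. Surjectivity of `Id + A` on L² amounts to
measurability of `ω ↦ J x`: Minty in L² at truncated constants yields it, and conversely the
pointwise resolvents of an L² function solve the equation once they are shown to lie in L². The
graph condition enters because `x ↦ (J x, x - J x)` parametrizes the graph continuously. -/

theorem mem_resolventOp {H : Type*} [NormedAddCommGroup H] {A : SetValuedOp H} {x p : H} :
    p ∈ A.resolventOp x ↔ x - p ∈ A p := by
  simp only [resolventOp, inverse, idAdd, Set.mem_ofPred_eq]
  constructor
  · rintro ⟨x', hx', rfl⟩
    simpa using hx'
  · exact fun h => ⟨_, h, by simp⟩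

/-! ### Minty's theorem and resolvents -/

section Minty

variable {H : Type*} [NormedAddCommGroup H] [InnerProductSpace ℝ H]

theorem IsMaximallyMonotone.mem_of_forall_inner_nonneg {A : SetValuedOp H}
    (hA : A.IsMaximallyMonotone) {u v : H}
    (h : ∀ a, ∀ a' ∈ A a, 0 ≤ inner ℝ (u - a) (v - a')) : v ∈ A u := by
  by_contra hv
  refine hA.2 ⟨fun x => {x' | x' ∈ A x ∨ (x = u ∧ x' = v)}, ?_, ?_⟩
  · rintro x y x' (hx | ⟨rfl, rfl⟩) y' (hy | ⟨rfl, rfl⟩)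
    · exact hA.1 x y x' hx y' hy
    · have := h x x' hx
      rwa [← neg_sub x, ← neg_sub x', inner_neg_neg] at this
    · exact h y y' hy
    · simp
  · refine ⟨fun p hp => Or.inl hp, fun hsub => hv ?_⟩
    exact @hsub (u, v) (Or.inr ⟨rfl, rfl⟩)

/-- `(x, y, t)` ranges over the epigraph of the Fitzpatrick function of `G`. Maximality makes that
function dominate the pairing, so the objective is nonnegative; the quadratic term forces minimizing
sequences to be Cauchy. -/
theorem exists_fitzpatrick_minimizer [CompleteSpace H] {G : Set (H × H)}
    (hne : G.Nonempty)
    (hmon : ∀ p ∈ G, ∀ q ∈ G, 0 ≤ inner ℝ (p.1 - q.1) (p.2 - q.2))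
    (hmax : ∀ u v : H, (∀ p ∈ G, 0 ≤ inner ℝ (u - p.1) (v - p.2)) → (u, v) ∈ G) :
    ∃ (x y : H) (t : ℝ),
      (∀ p ∈ G, inner ℝ x p.2 + inner ℝ p.1 y - inner ℝ p.1 p.2 ≤ t) ∧
      ∀ (u v : H) (s : ℝ), (∀ p ∈ G, inner ℝ u p.2 + inner ℝ p.1 v - inner ℝ p.1 p.2 ≤ s) →
        t + (‖x‖ ^ 2 + ‖y‖ ^ 2) / 2 ≤ s + (‖u‖ ^ 2 + ‖v‖ ^ 2) / 2 := by
  let C : Set (H × H × ℝ) :=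
    {z | ∀ p ∈ G, inner ℝ z.1 p.2 + inner ℝ p.1 z.2.1 - inner ℝ p.1 p.2 ≤ z.2.2}
  let φ : H × H × ℝ → ℝ := fun z => z.2.2 + (‖z.1‖ ^ 2 + ‖z.2.1‖ ^ 2) / 2
  have hCne : C.Nonempty := by
    obtain ⟨p, hp⟩ := hne
    refine ⟨(p.1, p.2, inner ℝ p.1 p.2), fun q hq => ?_⟩
    have := hmon p hp q hq
    simp only [inner_sub_left, inner_sub_right] at this
    dsimp only
    linarith
  have hle : ∀ z ∈ C, inner ℝ z.1 z.2.1 ≤ z.2.2 := by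
    rintro ⟨u, v, s⟩ hz
    by_contra! hlt
    dsimp only at hlt
    have hmem : (u, v) ∈ G := by
      refine hmax u v fun p hp => ?_
      have := hz p hp
      simp only [inner_sub_left, inner_sub_right]
      dsimp only at this
      linarith
    have := hz _ hmem
    dsimp only at this
    linarith
  have hnonneg : ∀ z ∈ C, 0 ≤ φ z := by
    intro z hz
    have h1 := hle z hz
    have h2 := norm_add_sq_real z.1 z.2.1
    have h3 := sq_nonneg ‖z.1 + z.2.1‖
    simp only [φ]
    linarith
  have hbdd : BddBelow (φ '' C) := ⟨0, by rintro _ ⟨z, hz, rfl⟩; exact hnonneg z hz⟩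
  set m := sInf (φ '' C)
  have hmle : ∀ z ∈ C, m ≤ φ z := fun z hz => csInf_le hbdd ⟨z, hz, rfl⟩
  have happrox : ∀ n : ℕ, ∃ z ∈ C, φ z < m + 1 / ((n : ℝ) + 1) := by
    intro n
    obtain ⟨_, ⟨z, hz, rfl⟩, hlt⟩ := exists_lt_of_csInf_lt (hCne.image φ)
      (lt_add_of_pos_right m (Nat.one_div_pos_of_nat (α := ℝ) (n := n)))
    exact ⟨z, hz, hlt⟩
  choose z hzC hzlt using happrox
  have hpar : ∀ a ∈ C, ∀ b ∈ C,
      ‖a.1 - b.1‖ ^ 2 + ‖a.2.1 - b.2.1‖ ^ 2 ≤ 4 * (φ a + φ b - 2 * m) := by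
    intro a ha b hb
    have hmid : ((1 / 2 : ℝ) • (a.1 + b.1), (1 / 2 : ℝ) • (a.2.1 + b.2.1), (a.2.2 + b.2.2) / 2)
        ∈ C := by
      intro p hp
      have h1 := ha p hp
      have h2 := hb p hp
      simp only [inner_smul_left, inner_smul_right, inner_add_left, inner_add_right]
      norm_num
      linarith
    have h := hmle _ hmid
    have e1 := parallelogram_law_with_norm ℝ a.1 b.1
    have e2 := parallelogram_law_with_norm ℝ a.2.1 b.2.1
    simp only [φ, norm_smul, mul_pow] at h ⊢
    norm_num at h
    nlinarith
  have hdist : ∀ N k l : ℕ, N ≤ k → N ≤ l →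
      ‖(z k).1 - (z l).1‖ ^ 2 + ‖(z k).2.1 - (z l).2.1‖ ^ 2 ≤ 8 * (1 / ((N : ℝ) + 1)) := by
    intro N k l hk hl
    have h := hpar _ (hzC k) _ (hzC l)
    have h1 := hzlt k
    have h2 := hzlt l
    have h3 := Nat.one_div_le_one_div (α := ℝ) hk
    have h4 := Nat.one_div_le_one_div (α := ℝ) hl
    linarith
  have htend : Filter.Tendsto (fun N : ℕ => Real.sqrt (8 * (1 / ((N : ℝ) + 1)))) Filter.atTop
      (nhds 0) := by
    have := (tendsto_one_div_add_atTop_nhds_zero_nat (𝕜 := ℝ)).const_mul 8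
    simpa using this.sqrt
  have hc1 : CauchySeq fun n => (z n).1 := by
    refine cauchySeq_of_le_tendsto_0 _ (fun k l N hk hl => ?_) htend
    rw [dist_eq_norm]
    refine Real.le_sqrt_of_sq_le ?_
    have := hdist N k l hk hl
    nlinarith [sq_nonneg ‖(z k).2.1 - (z l).2.1‖]
  have hc2 : CauchySeq fun n => (z n).2.1 := by
    refine cauchySeq_of_le_tendsto_0 _ (fun k l N hk hl => ?_) htend
    rw [dist_eq_norm]
    refine Real.le_sqrt_of_sq_le ?_
    have := hdist N k l hk hl
    nlinarith [sq_nonneg ‖(z k).1 - (z l).1‖]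
  obtain ⟨x, hx⟩ := cauchySeq_tendsto_of_complete hc1
  obtain ⟨y, hy⟩ := cauchySeq_tendsto_of_complete hc2
  -- This height makes the objective exactly `m`, so the heights of the minimizing sequence need not
  -- be shown to converge.
  refine ⟨x, y, m - (‖x‖ ^ 2 + ‖y‖ ^ 2) / 2, fun p hp => ?_, fun u v s hs => ?_⟩
  · have hl : Filter.Tendsto
        (fun n => inner ℝ (z n).1 p.2 + inner ℝ p.1 (z n).2.1 - inner ℝ p.1 p.2) Filter.atTop
        (nhds (inner ℝ x p.2 + inner ℝ p.1 y - inner ℝ p.1 p.2)) :=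
      ((hx.inner tendsto_const_nhds).add (tendsto_const_nhds.inner hy)).sub_const _
    have hr : Filter.Tendsto
        (fun n : ℕ => m + 1 / ((n : ℝ) + 1) - (‖(z n).1‖ ^ 2 + ‖(z n).2.1‖ ^ 2) / 2) Filter.atTop
        (nhds (m + 0 - (‖x‖ ^ 2 + ‖y‖ ^ 2) / 2)) :=
      (tendsto_one_div_add_atTop_nhds_zero_nat.const_add m).sub
        (((hx.norm.pow 2).add (hy.norm.pow 2)).div_const 2)
    rw [add_zero] at hr
    refine le_of_tendsto_of_tendsto' hl hr fun n => ?_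
    have h1 := hzC n p hp
    have h2 := hzlt n
    simp only [φ] at h2
    linarith
  · have := hmle (u, v, s) hs
    simp only [φ] at this
    linarith

/-- Optimality of the Fitzpatrick minimizer `(x, y)` makes `(-y, -x)` monotonically related to `G`
with excess `‖x + y‖ ^ 2`. Maximality puts it in `G`, and testing it against itself gives `y = -x`.
-/
theorem exists_mem_neg_of_maximal [CompleteSpace H] {G : Set (H × H)}
    (hmon : ∀ p ∈ G, ∀ q ∈ G, 0 ≤ inner ℝ (p.1 - q.1) (p.2 - q.2))
    (hmax : ∀ u v : H, (∀ p ∈ G, 0 ≤ inner ℝ (u - p.1) (v - p.2)) → (u, v) ∈ G) :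
    ∃ x : H, (x, -x) ∈ G := by
  have hne : G.Nonempty := by
    by_contra h
    rw [Set.not_nonempty_iff_eq_empty] at h
    have := hmax 0 0 (by simp [h])
    simp [h] at this
  obtain ⟨x, y, t, hfeas, hmin⟩ := exists_fitzpatrick_minimizer hne hmon hmax
  have hxy : inner ℝ x y ≤ t := by
    by_contra! hlt
    have hmem : (x, y) ∈ G := by
      refine hmax x y fun p hp => ?_
      have := hfeas p hp
      simp only [inner_sub_left, inner_sub_right]
      linarith
    have := hfeas _ hmem
    dsimp only at this
    linarith
  -- First-order optimality along the segment from the minimizer to a point of the graph.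
  have hopt : ∀ p ∈ G, t + ‖x‖ ^ 2 + ‖y‖ ^ 2 ≤
      inner ℝ p.1 p.2 + inner ℝ x p.1 + inner ℝ y p.2 := by
    intro p hp
    have key : ∀ r : ℝ, 0 < r → r ≤ 1 → 0 ≤ (inner ℝ p.1 p.2 - t) + (inner ℝ x (p.1 - x) +
        inner ℝ y (p.2 - y)) + r * ((‖p.1 - x‖ ^ 2 + ‖p.2 - y‖ ^ 2) / 2) := by
      intro r hr hr1
      -- Monotonicity puts `(p.1, p.2, ⟪p.1, p.2⟫)` in the convex epigraph, so the segment to it is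
      -- feasible.
      have h := hmin (x + r • (p.1 - x)) (y + r • (p.2 - y)) (t + r * (inner ℝ p.1 p.2 - t))
        (fun q hq => by
          have h1 := hfeas q hq
          have h2 := hmon p hp q hq
          simp only [inner_sub_left, inner_sub_right, inner_add_left, inner_add_right,
            real_inner_smul_left, real_inner_smul_right] at h2 ⊢
          nlinarith [mul_nonneg (sub_nonneg.2 hr1) (sub_nonneg.2 h1), mul_nonneg hr.le h2])
      rw [norm_add_sq_real, norm_add_sq_real, norm_smul, norm_smul, real_inner_smul_right,
        real_inner_smul_right, mul_pow, mul_pow, Real.norm_eq_abs, sq_abs] at h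
      refine nonneg_of_mul_nonneg_right (a := r) ?_ hr
      nlinarith
    have hlim : Filter.Tendsto (fun r : ℝ => (inner ℝ p.1 p.2 - t) + (inner ℝ x (p.1 - x) +
        inner ℝ y (p.2 - y)) + r * ((‖p.1 - x‖ ^ 2 + ‖p.2 - y‖ ^ 2) / 2)) (nhdsWithin 0 (Set.Ioi 0))
        (nhds ((inner ℝ p.1 p.2 - t) + (inner ℝ x (p.1 - x) +
        inner ℝ y (p.2 - y)) + 0 * ((‖p.1 - x‖ ^ 2 + ‖p.2 - y‖ ^ 2) / 2))) :=
      Filter.Tendsto.mono_left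
        (Continuous.tendsto (by fun_prop) 0) nhdsWithin_le_nhds
    have h0 := ge_of_tendsto hlim (by
      filter_upwards [Ioc_mem_nhdsGT (zero_lt_one' ℝ)] with r hr using key r hr.1 hr.2)
    simp only [inner_sub_right, real_inner_self_eq_norm_sq] at h0
    linarith
  have hkey : ∀ p ∈ G, ‖x + y‖ ^ 2 ≤ inner ℝ (-y - p.1) (-x - p.2) := by
    intro p hp
    have h := hopt p hp
    rw [norm_add_sq_real]
    simp only [inner_sub_left, inner_sub_right, inner_neg_left, inner_neg_right]
    rw [real_inner_comm x y, real_inner_comm x p.1]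
    linarith
  have hmem : (-y, -x) ∈ G := hmax _ _ fun p hp => (sq_nonneg _).trans (hkey p hp)
  have h0 := hkey _ hmem
  simp only [sub_self, inner_zero_left] at h0
  have hsum : x + y = 0 := by
    rw [← norm_eq_zero]
    exact pow_eq_zero_iff two_ne_zero |>.1 (le_antisymm h0 (sq_nonneg _))
  refine ⟨x, ?_⟩
  rwa [← eq_neg_of_add_eq_zero_left hsum] at hmem

/-- **Minty's theorem**: the range of `Id + A` is the whole space. -/
theorem IsMaximallyMonotone.exists_sub_mem [CompleteSpace H] {A : SetValuedOp H}
    (hA : A.IsMaximallyMonotone) (x : H) : ∃ y, x - y ∈ A y := by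
  obtain ⟨y, hy⟩ := exists_mem_neg_of_maximal (G := {p : H × H | p.2 + x ∈ A p.1})
    (fun p hp q hq => by simpa using hA.1 _ _ _ hp _ hq)
    (fun u v h => hA.mem_of_forall_inner_nonneg fun a a' ha => by
      have := h (a, a' - x) (by simpa using ha)
      rwa [sub_sub_eq_add_sub] at this)
  refine ⟨y, ?_⟩
  rwa [Set.mem_ofPred_eq, neg_add_eq_sub] at hy

/-- For `(u, v)` in a monotone extension, solve the inclusion at `u + v`; monotonicity gives `-‖u -
y‖ ^ 2 ≥ 0`, hence `u = y`. -/
theorem isMaximallyMonotone_of_exists_sub_mem {A : SetValuedOp H} (hA : A.IsMonotone)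
    (h : ∀ x, ∃ y, x - y ∈ A y) : A.IsMaximallyMonotone := by
  refine ⟨hA, ?_⟩
  rintro ⟨B, hB, hAB, hBA⟩
  refine hBA fun ⟨u, v⟩ huv => ?_
  obtain ⟨y, hy⟩ := h (u + v)
  have h1 := hB u y v huv _ (hAB (show (y, u + v - y) ∈ A.gra from hy))
  have huy : u = y := by
    rw [show v - (u + v - y) = -(u - y) by abel, inner_neg_right,
      real_inner_self_eq_norm_sq] at h1
    have : ‖u - y‖ = 0 := by
      refine pow_eq_zero_iff two_ne_zero |>.1 (le_antisymm ?_ (sq_nonneg _))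
      linarith
    exact sub_eq_zero.1 (norm_eq_zero.1 this)
  subst huy
  simpa [gra] using hy

theorem IsMonotone.norm_sub_le {A : SetValuedOp H} (hA : A.IsMonotone) {a a' b b' : H}
    (ha : a' ∈ A a) (hb : b' ∈ A b) : ‖a - b‖ ≤ ‖(a + a') - (b + b')‖ := by
  have h := hA a b a' ha b' hb
  rw [show (a + a') - (b + b') = (a - b) + (a' - b') by abel]
  refine (sq_le_sq₀ (norm_nonneg _) (norm_nonneg _)).1 ?_
  rw [norm_add_sq_real]
  nlinarith [sq_nonneg ‖a' - b'‖]

theorem IsMaximallyMonotone.sub_resolventMap_mem [CompleteSpace H] {A : SetValuedOp H}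
    (hA : A.IsMaximallyMonotone) (x : H) : x - A.resolventMap x ∈ A (A.resolventMap x) := by
  have h : (A.resolventOp x).Nonempty := by
    obtain ⟨y, hy⟩ := hA.exists_sub_mem x
    exact ⟨y, mem_resolventOp.2 hy⟩
  rw [resolventMap, dif_pos h]
  exact mem_resolventOp.1 h.some_mem

theorem IsMaximallyMonotone.norm_resolventMap_sub_le [CompleteSpace H] {A : SetValuedOp H}
    (hA : A.IsMaximallyMonotone) {x b b' : H} (hb : b' ∈ A b) :
    ‖A.resolventMap x - b‖ ≤ ‖x - (b + b')‖ := by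
  simpa using hA.1.norm_sub_le (hA.sub_resolventMap_mem x) hb

theorem IsMaximallyMonotone.resolventMap_eq [CompleteSpace H] {A : SetValuedOp H}
    (hA : A.IsMaximallyMonotone) {x p : H} (hp : x - p ∈ A p) : A.resolventMap x = p := by
  have := hA.norm_resolventMap_sub_le (x := x) hp
  simpa [sub_eq_zero] using this

theorem IsMaximallyMonotone.resolventOp_eq [CompleteSpace H] {A : SetValuedOp H}
    (hA : A.IsMaximallyMonotone) (x : H) : A.resolventOp x = {A.resolventMap x} := by
  ext p
  rw [mem_resolventOp, Set.mem_singleton_iff]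
  refine ⟨fun h => (hA.resolventMap_eq h).symm, ?_⟩
  rintro rfl
  exact hA.sub_resolventMap_mem x

theorem IsMaximallyMonotone.continuous_resolventMap [CompleteSpace H] {A : SetValuedOp H}
    (hA : A.IsMaximallyMonotone) : Continuous A.resolventMap := by
  refine LipschitzWith.continuous (K := 1) (LipschitzWith.of_dist_le_mul fun x y => ?_)
  simpa [dist_eq_norm] using hA.norm_resolventMap_sub_le (x := x) (hA.sub_resolventMap_mem y)

end Minty

theorem isMonotone_inducedOp {Ω H : Type*} [MeasurableSpace Ω] [NormedAddCommGroup H]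
    [InnerProductSpace ℝ H] {μ : Measure Ω} {A : Ω → SetValuedOp H}
    (hA : ∀ ω, (A ω).IsMonotone) : (inducedOp μ A).IsMonotone := by
  intro x y x' hx y' hy
  rw [L2.inner_def]
  refine integral_nonneg_of_ae ?_
  filter_upwards [hx, hy, Lp.coeFn_sub x y, Lp.coeFn_sub x' y'] with ω h1 h2 h3 h4
  rw [h3, h4]
  exact hA ω _ _ _ h1 _ h2

/-! ### Measurable dependence on `ω` -/

section Measurability

variable {Ω H : Type*} [MeasurableSpace Ω] [NormedAddCommGroup H] [InnerProductSpace ℝ H]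
  [CompleteSpace H]

/-- Graph points whose coordinate sum is near `x` have first coordinate near `J x`, so countably
many open tests decide whether `J x` lies in a closed set. -/
theorem measurable_resolventMap_of_measurableSet_gra [MeasurableSpace H] [BorelSpace H]
    {A : Ω → SetValuedOp H} (hA : ∀ ω, (A ω).IsMaximallyMonotone)
    (h : ∀ V : Set (H × H), IsOpen V → MeasurableSet {ω | (V ∩ (A ω).gra).Nonempty}) (x : H) :
    Measurable fun ω => (A ω).resolventMap x := by
  refine measurable_of_isClosed fun F hF => ?_
  let V : ℕ → Set (H × H) := fun n =>
    {p | ‖x - (p.1 + p.2)‖ < 1 / ((n : ℝ) + 1)} ∩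
      Prod.fst ⁻¹' Metric.thickening (1 / ((n : ℝ) + 1)) F
  have hV : ∀ n, IsOpen (V n) := fun n =>
    (isOpen_lt (by fun_prop) continuous_const).inter
      (Metric.isOpen_thickening.preimage continuous_fst)
  have heq : (fun ω => (A ω).resolventMap x) ⁻¹' F =
      ⋂ n, {ω | (V n ∩ (A ω).gra).Nonempty} := by
    ext ω
    simp only [Set.mem_preimage, Set.mem_iInter, Set.mem_ofPred_eq]
    constructor
    · intro hω n
      have hpos := Nat.one_div_pos_of_nat (α := ℝ) (n := n)
      refine ⟨((A ω).resolventMap x, x - (A ω).resolventMap x), ⟨?_, ?_⟩,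
        (hA ω).sub_resolventMap_mem x⟩
      · simpa using hpos
      · exact Metric.self_subset_thickening hpos F hω
    · intro hω
      choose p hpV hpA using hω
      have hlim : Filter.Tendsto (fun n => (p n).1) Filter.atTop
          (nhds ((A ω).resolventMap x)) := by
        rw [tendsto_iff_norm_sub_tendsto_zero]
        refine squeeze_zero (fun _ => norm_nonneg _) (fun n => ?_)
          (tendsto_one_div_add_atTop_nhds_zero_nat (𝕜 := ℝ))
        rw [norm_sub_rev]
        exact ((hA ω).norm_resolventMap_sub_le (hpA n)).trans (hpV n).1.le
      have hclos : (A ω).resolventMap x ∈ closure F := by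
        rw [Metric.mem_closure_iff]
        intro ε hε
        have h1 := (Metric.tendsto_nhds.1 hlim (ε / 2) (half_pos hε))
        have h2 := (tendsto_one_div_add_atTop_nhds_zero_nat (𝕜 := ℝ)).eventually_lt_const
          (half_pos hε)
        obtain ⟨n, hn1, hn2⟩ := (h1.and h2).exists
        obtain ⟨b, hb, hlt⟩ := Metric.mem_thickening_iff.1 (hpV n).2
        refine ⟨b, hb, ?_⟩
        have := dist_triangle_left ((A ω).resolventMap x) b (p n).1
        linarith
      rwa [hF.closure_eq] at hclos
  rw [heq]
  exact MeasurableSet.iInter fun n => h _ (hV n)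

theorem measurableSet_gra_of_measurable_resolventMap [TopologicalSpace.SeparableSpace H]
    [MeasurableSpace H] [BorelSpace H]
    {A : Ω → SetValuedOp H} (hA : ∀ ω, (A ω).IsMaximallyMonotone)
    (h : ∀ x : H, Measurable fun ω => (A ω).resolventMap x) {V : Set (H × H)} (hV : IsOpen V) :
    MeasurableSet {ω | (V ∩ (A ω).gra).Nonempty} := by
  have : SecondCountableTopology H := UniformSpace.secondCountable_of_separable H
  have heq : {ω | (V ∩ (A ω).gra).Nonempty} =
      ⋃ n, (fun ω => ((A ω).resolventMap (TopologicalSpace.denseSeq H n),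
        TopologicalSpace.denseSeq H n - (A ω).resolventMap (TopologicalSpace.denseSeq H n)))
          ⁻¹' V := by
    ext ω
    simp only [Set.mem_ofPred_eq, Set.mem_iUnion, Set.mem_preimage]
    constructor
    · rintro ⟨⟨a, a'⟩, haV, ha⟩
      have hcont : Continuous fun x => ((A ω).resolventMap x, x - (A ω).resolventMap x) :=
        have := (hA ω).continuous_resolventMap
        by fun_prop
      have hJ : (A ω).resolventMap (a + a') = a :=
        (hA ω).resolventMap_eq (by simpa [gra] using ha)
      exact (TopologicalSpace.denseRange_denseSeq H).exists_mem_open (hV.preimage hcont)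
        ⟨a + a', by simpa [hJ] using haV⟩
    · rintro ⟨n, hn⟩
      exact ⟨_, hn, (hA ω).sub_resolventMap_mem _⟩
  rw [heq]
  exact MeasurableSet.iUnion fun n =>
    ((h _).prodMk ((h _).const_sub _)) hV.measurableSet

theorem isMaximallyMonotone_inducedOp_of_measurable [TopologicalSpace.SeparableSpace H]
    [MeasurableSpace H] [BorelSpace H] {μ : Measure Ω} {A : Ω → SetValuedOp H}
    (hA : ∀ ω, (A ω).IsMaximallyMonotone) (hdom : (inducedOp μ A).dom.Nonempty)
    (h : ∀ x : H, Measurable fun ω => (A ω).resolventMap x) :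
    (inducedOp μ A).IsMaximallyMonotone := by
  have : SecondCountableTopology H := UniformSpace.secondCountable_of_separable H
  refine isMaximallyMonotone_of_exists_sub_mem (isMonotone_inducedOp fun ω => (hA ω).1)
    fun x => ?_
  obtain ⟨x₀, x₀', hx₀⟩ := hdom
  have hJ : Measurable fun p : H × Ω => (A p.2).resolventMap p.1 :=
    (stronglyMeasurable_uncurry_of_continuous_of_stronglyMeasurable
      (u := fun x ω => (A ω).resolventMap x)
      (fun ω => (hA ω).continuous_resolventMap) fun x => (h x).stronglyMeasurable).measurable
  have hmeas : AEStronglyMeasurable (fun ω => (A ω).resolventMap (x ω)) μ :=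
    (hJ.comp ((Lp.stronglyMeasurable x).measurable.prodMk measurable_id)).aestronglyMeasurable
  -- Since `x₀ = J (x₀ + x₀')` almost everywhere, nonexpansiveness bounds this by `‖x - (x₀ +
  -- x₀')‖`. Constants need not be in L², so a domain point is required.
  have hdiff : MemLp (fun ω => (A ω).resolventMap (x ω) - x₀ ω) 2 μ := by
    refine MemLp.mono (Lp.memLp (x - (x₀ + x₀')))
      (hmeas.sub (Lp.aestronglyMeasurable x₀)) ?_
    filter_upwards [hx₀, Lp.coeFn_sub x (x₀ + x₀'), Lp.coeFn_add x₀ x₀'] with ω h1 h2 h3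
    rw [h2, Pi.sub_apply, h3, Pi.add_apply]
    exact (hA ω).norm_resolventMap_sub_le h1
  have hmem : MemLp (fun ω => (A ω).resolventMap (x ω)) 2 μ := by
    simpa [Pi.add_def] using hdiff.add (Lp.memLp x₀)
  refine ⟨hmem.toLp, ?_⟩
  change ∀ᵐ ω ∂μ, _
  filter_upwards [hmem.coeFn_toLp, Lp.coeFn_sub x hmem.toLp] with ω h1 h2
  rw [h2, Pi.sub_apply, h1]
  exact (hA ω).sub_resolventMap_mem _

theorem measurable_resolventMap_of_isMaximallyMonotone_inducedOp
    [TopologicalSpace.SeparableSpace H] [MeasurableSpace H] [BorelSpace H]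
    {μ : Measure Ω} [μ.IsComplete] [SigmaFinite μ] {A : Ω → SetValuedOp H}
    (hA : ∀ ω, (A ω).IsMaximallyMonotone) (h : (inducedOp μ A).IsMaximallyMonotone) (x : H) :
    Measurable fun ω => (A ω).resolventMap x := by
  have : SecondCountableTopology H := UniformSpace.secondCountable_of_separable H
  -- Completeness reduces the claim to a.e. measurability, checked on finite-measure pieces where
  -- the constant `x` can be truncated into L².
  rw [← aemeasurable_iff_measurable (μ := μ), ← Measure.restrict_univ (μ := μ),
    ← iUnion_spanningSets μ, aemeasurable_iUnion_iff]
  intro n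
  have hS := measurableSet_spanningSets μ n
  have hmem : MemLp ((spanningSets μ n).indicator fun _ => x) 2 μ :=
    memLp_indicator_const 2 hS x (Or.inr (measure_spanningSets_lt_top μ n).ne)
  obtain ⟨y, hy⟩ := h.exists_sub_mem hmem.toLp
  refine ⟨y, (Lp.stronglyMeasurable y).measurable, ?_⟩
  rw [Filter.EventuallyEq, ae_restrict_iff' hS]
  filter_upwards [hy, hmem.coeFn_toLp, Lp.coeFn_sub hmem.toLp y] with ω h1 h2 h3 hω
  rw [h3, Pi.sub_apply, h2, Set.indicator_of_mem hω] at h1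
  exact (hA ω).resolventMap_eq h1

end Measurability

end SetValuedOp

theorem corollaryc {Ω H : Type*} [MeasurableSpace Ω] (μ : Measure Ω) [μ.IsComplete] [SigmaFinite μ]
    [NormedAddCommGroup H] [InnerProductSpace ℝ H] [CompleteSpace H]
    [TopologicalSpace.SeparableSpace H] [MeasurableSpace H] [BorelSpace H]
    (A : Ω → SetValuedOp H) (hA : ∀ ω, (A ω).IsMaximallyMonotone)
    (hdom : (inducedOp μ A).dom.Nonempty) :
    (∀ (ω : Ω) (x : H), ∃ p : H, (A ω).resolventOp x = {p}) ∧
    List.TFAE [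
      (inducedOp μ A).IsMaximallyMonotone,
      ∀ x : H, Measurable fun ω => (A ω).resolventMap x,
      ∀ V : Set (H × H), IsOpen V → MeasurableSet {ω | (V ∩ (A ω).gra).Nonempty}] := by
  refine ⟨fun ω x => ⟨_, (hA ω).resolventOp_eq x⟩, ?_⟩
  tfae_have 1 → 2 :=
    SetValuedOp.measurable_resolventMap_of_isMaximallyMonotone_inducedOp hA
  tfae_have 2 → 1 :=
    SetValuedOp.isMaximallyMonotone_inducedOp_of_measurable hA hdom
  tfae_have 2 → 3 := fun h _ hV =>
    SetValuedOp.measurableSet_gra_of_measurable_resolventMap hA h hV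
  tfae_have 3 → 2 :=
    SetValuedOp.measurable_resolventMap_of_measurableSet_gra hA
  tfae_finish
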